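/- Let $a\in[-1,0)$ and let $\sigma(\tau)=1$ for $\tau>0$, $\sigma(\tau)=a$ for $\tau<0$. For $\xi\in\mathbb R$ let $\mathfrak h_a[\xi]=-\frac{d^2}{d\tau^2}+(\xi+\sigma(\tau)\tau)^2$ in $L^2(\mathbb R)$, with domain $\{u\in B^1(\mathbb R):\ \mathfrak h_a[\xi]u\in L^2(\mathbb R)\}$, where $B^1(\mathbb R)=\{u\in L^2(\mathbb R):\ u',\ \tau u\in L^2(\mathbb R)\}$ and derivatives are weak; let $$\mu_a(\xi)=\inf_{u\in B^1(\mathbb R),\,u\ne0}\frac{\int_{\mathbb R}\big(|u'|^2+(\xi+\sigma(\tau)\tau)^2|u|^2\big)\,d\tau}{\int_{\mathbb R}|u|^2\,d\tau},\qquad \beta_a=\inf_{\xi\in\mathbb R}\mu_a(\xi).$$ Let $\zeta_a\in\mathbb R$ be a minimizer of $\mu_a$, i.e. $\mu_a(\zeta_a)=\beta_a$, and let $\phi_a$ be the positive $L^2$-normalized ground state of $\mathfrak h_a[\zeta_a]$, i.e. (its continuous representative satisfies) $\phi_a>0$, $\mathfrak h_a[\zeta_a]\phi_a=\mu_a(\zeta_a)\phi_a$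 and $\int_{\mathbb R}\phi_a^2\,d\tau=1$. Then $\phi_a$ is differentiable at $0$, the integrals $$M_n(a)=\int_{-\infty}^{+\infty}\frac1{\sigma(\tau)}\big(\zeta_a+\sigma(\tau)\tau\big)^n|\phi_a(\tau)|^2\,d\tau\qquad(n=0,1,2,\dots)$$ converge absolutely, and $$M_1(a)=0,$$ $$M_2(a)=\frac12\,\beta_a\int_{-\infty}^{+\infty}\frac1{\sigma(\tau)}|\phi_a(\tau)|^2\,d\tau+\frac14\Big(\frac1a-1\Big)\phi_a(0)\phi_a'(0),$$ $$M_3(a)=\frac13\Big(\frac1a-1\Big)\zeta_a\,\phi_a(0)\phi_a'(0).$$ Moreover, $M_3(a)<0$ if $a\in(-1,0)$. -/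

import Mathlib

open MeasureTheory
open scoped ContDiff

namespace MagneticStep

noncomputable section

/-- The step function `σ = 1` on the positive half-line, `σ = a` on the negative half-line
(the value at the single point `0` is immaterial: `σ` enters only through integrals
and through `σ(τ) τ`). -/
def step (a τ : ℝ) : ℝ := if 0 < τ then 1 else a

/-- The potential `V_a(ξ, τ) = (ξ + σ(τ) τ)²`. -/
def potential (a ξ τ : ℝ) : ℝ := (ξ + step a τ * τ) ^ 2

/-- `v` is the weak (distributional) derivative of `u` on the real line. -/
def HasWeakDeriv (u v : ℝ → ℂ) : Prop :=
  LocallyIntegrable u ∧ LocallyIntegrable v ∧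
    ∀ ψ : ℝ → ℝ, ContDiff ℝ ∞ ψ → HasCompactSupport ψ →
      ∫ τ, deriv ψ τ • u τ = - ∫ τ, ψ τ • v τ

/-- `u` lies in the space `B¹(ℝ) = {u ∈ L² : τ u ∈ L², u' ∈ L²}`, with weak derivative `u' = v`. -/
structure MemB1 (u v : ℝ → ℂ) : Prop where
  memLp : MemLp u 2
  memLp_mul : MemLp (fun τ : ℝ => τ • u τ) 2
  hasWeakDeriv : HasWeakDeriv u v
  memLp_deriv : MemLp v 2

/-- The quadratic form `q_a[ξ](u) = ∫ (|u'|² + V_a(ξ, ·) |u|²)`, where `v = u'`. -/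
def quadForm (a ξ : ℝ) (u v : ℝ → ℂ) : ℝ :=
  ∫ τ, (‖v τ‖ ^ 2 + potential a ξ τ * ‖u τ‖ ^ 2)

/-- The lowest band function: `μ_a(ξ)` is the infimum of `q_a[ξ](u) / ‖u‖²` over the nonzero
`u ∈ B¹(ℝ)`. -/
def bandFun (a ξ : ℝ) : ℝ :=
  sInf {r : ℝ | ∃ u v : ℝ → ℂ, MemB1 u v ∧ ¬ (u =ᵐ[volume] 0) ∧
    r = quadForm a ξ u v / ∫ τ, ‖u τ‖ ^ 2}

/-- The step constant `β_a`, the infimum over `ξ` of `μ_a(ξ)`. -/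
def stepConst (a : ℝ) : ℝ := ⨅ ξ : ℝ, bandFun a ξ

/-- `u` is in the domain of `𝔥_a[ξ] = -d²/dτ² + V_a(ξ, ·)` and `𝔥_a[ξ] u = f`:
`u ∈ B¹(ℝ)`, `f ∈ L²(ℝ)`, and `-u'' + V_a(ξ, ·) u = f` with weak derivatives
(`v = u'`, `w = u''`). -/
def FiberOpEq (a ξ : ℝ) (u f : ℝ → ℂ) : Prop :=
  MemLp f 2 ∧ ∃ v w : ℝ → ℂ, MemB1 u v ∧ HasWeakDeriv v w ∧
    ∀ᵐ τ, - w τ + potential a ξ τ • u τ = f τ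

/-- `φ` is (the continuous representative of) the positive `L²`-normalized ground state
of `𝔥_a[ξ]`. -/
structure IsGroundState (a ξ : ℝ) (φ : ℝ → ℝ) : Prop where
  continuous : Continuous φ
  pos : ∀ τ, 0 < φ τ
  eigen : FiberOpEq a ξ (fun τ => (φ τ : ℂ)) (fun τ => ((bandFun a ξ * φ τ : ℝ) : ℂ))
  normalized : ∫ τ, φ τ ^ 2 = 1

/-- The integrand `σ(τ)⁻¹ (ζ + σ(τ) τ)ⁿ |φ(τ)|²` of the `n`-th moment. -/
def momentIntegrand (a ζ : ℝ) (φ : ℝ → ℝ) (n : ℕ) (τ : ℝ) : ℝ :=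
  1 / step a τ * (ζ + step a τ * τ) ^ n * φ τ ^ 2

/-- The `n`-th moment `∫ σ(τ)⁻¹ (ζ + σ(τ) τ)ⁿ |φ(τ)|² dτ`. -/
def moment (a ζ : ℝ) (φ : ℝ → ℝ) (n : ℕ) : ℝ :=
  ∫ τ, momentIntegrand a ζ φ n τ

end

end MagneticStep

/-! On each side of 0 the potential is a quadratic polynomial. Hence φ and its reflection x ↦ φ(-x)
both solve -f'' + (ζ + kx)² f = μ f on [0, ∞), with k = 1 and k = -a respectively
(`IsHalfLineState`). Both decay exponentially with their derivatives, so all moments converge and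
one may test the equation against polynomial multipliers without boundary terms at infinity
(`integral_virial`). The multipliers 1, ζ + kx and (ζ + kx)² yield the half-line moments of orders
1, 2 and 3 in terms of f(0), f'(0) and lower moments.

The order-one identity has the same right-hand side F = φ'(0)² + (μ - ζ²) φ(0)² on both sides, since
reflection only flips the sign of φ'(0). Minimality of ζ makes the first moment without the weight
1/σ vanish (`IsGroundState.stationary`), which forces F = 0. So each half-line first moment is zero;
this gives M₁ = 0 and ζ < 0, and removes F from the identities for M₂ and M₃.

By its formula M₃ has the sign of φ'(0). If φ'(0) ≥ 0, the reflected left part starts with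
nonpositive slope, and F = 0 makes its slope negative up to the well (`deriv_neg`). Rescaling it so
that its potential matches the right one only raises its energy, and a Wronskian argument gives a
contradiction (`deriv_zero_neg_of_slope_lt_one`). -/

namespace MagneticStep

/-! ### Weak derivatives and regularity of the ground state -/

/-- A smooth compactly supported function with zero mean is the derivative of a smooth compactly
supported function. -/
theorem exists_antideriv_of_integral_eq_zero {η : ℝ → ℝ} (hη : ContDiff ℝ ∞ η)
    (hc : HasCompactSupport η) (h0 : ∫ x, η x = 0) :
    ∃ ψ : ℝ → ℝ, ContDiff ℝ ∞ ψ ∧ HasCompactSupport ψ ∧ deriv ψ = η := by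
  obtain ⟨R, hR⟩ := hc.isCompact.isBounded.subset_ball 0
  have hsupp : ∀ x, R ≤ |x| → η x = 0 := by
    intro x hx
    by_contra h
    have := hR (subset_tsupport η h)
    simp at this
    linarith
  have hd : ∀ x, HasDerivAt (fun x => ∫ t in (-R)..x, η t) (η x) x := fun x =>
    intervalIntegral.integral_hasDerivAt_right (hη.continuous.intervalIntegrable _ _)
      (hη.continuous.stronglyMeasurableAtFilter _ _) hη.continuous.continuousAt
  have hde : deriv (fun x => ∫ t in (-R)..x, η t) = η := funext fun x => (hd x).deriv
  refine ⟨fun x => ∫ t in (-R)..x, η t, ?_, ?_, hde⟩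
  · rw [contDiff_infty_iff_deriv]
    exact ⟨fun x => (hd x).differentiableAt, by rw [hde]; exact hη⟩
  · refine HasCompactSupport.intro (isCompact_Icc (a := -R) (b := R)) fun x hx => ?_
    rw [Set.mem_Icc, not_and_or, not_le, not_le] at hx
    rcases hx with hx | hx
    · rw [intervalIntegral.integral_congr (g := fun _ => (0 : ℝ)), intervalIntegral.integral_zero]
      intro t ht
      by_cases hRx : x ≤ -R
      · rw [Set.uIcc_of_ge hRx] at ht
        refine hsupp t ?_
        have := neg_le_abs t
        linarith [ht.2]
      · exact absurd hx.le hRx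
    · rw [← h0]
      refine intervalIntegral.integral_eq_integral_of_support_subset fun t ht => ?_
      have : |t| < R := not_le.1 fun h => ht (hsupp t h)
      rw [abs_lt] at this
      exact ⟨this.1, by linarith [this.2]⟩

/-- The du Bois-Reymond lemma on the real line. -/
theorem ae_eq_const_of_integral_deriv_mul_eq_zero {g : ℝ → ℝ} (hg : LocallyIntegrable g)
    (h : ∀ ψ : ℝ → ℝ, ContDiff ℝ ∞ ψ → HasCompactSupport ψ → ∫ x, deriv ψ x * g x = 0) :
    ∃ c : ℝ, ∀ᵐ x, g x = c := by
  let B : ContDiffBump (0 : ℝ) := ⟨1, 2, one_pos, one_lt_two⟩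
  set χ : ℝ → ℝ := B.normed volume with hχ
  have hχs : ContDiff ℝ ∞ χ := B.contDiff_normed
  have hχc : HasCompactSupport χ := B.hasCompactSupport_normed
  have hχ1 : ∫ x, χ x = 1 := B.integral_normed
  have int : ∀ η : ℝ → ℝ, ContDiff ℝ ∞ η → HasCompactSupport η →
      Integrable fun x => η x * g x := fun η h1 h2 =>
    hg.integrable_smul_left_of_hasCompactSupport h1.continuous h2
  refine ⟨∫ x, χ x * g x, ?_⟩
  have key : ∀ᵐ x, g x - ∫ y, χ y * g y = 0 := by
    refine ae_eq_zero_of_integral_contDiff_smul_eq_zero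
      (hg.sub (locallyIntegrable_const _)) fun η hη hηc => ?_
    have hηi : Integrable η := hη.continuous.integrable_of_hasCompactSupport hηc
    have hχi : Integrable χ := hχs.continuous.integrable_of_hasCompactSupport hχc
    -- Since χ has mass one, subtracting (∫ η) χ leaves a zero-mean function, hence an admissible
    -- derivative; the subtracted term produces the constant ∫ χ g.
    obtain ⟨ψ, h1, h2, h3⟩ := exists_antideriv_of_integral_eq_zero
      (η := fun x => η x - (∫ y, η y) * χ x) (hη.sub (contDiff_const.mul hχs))
      (hηc.sub (hχc.mul_left (f := fun _ => ∫ y, η y)))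
      (by rw [integral_sub hηi (hχi.const_mul _), integral_const_mul, hχ1, mul_one, sub_self])
    have h4 := h ψ h1 h2
    simp only [h3] at h4
    have e1 : ∀ x, (η x - (∫ y, η y) * χ x) * g x = η x * g x - (∫ y, η y) * (χ x * g x) :=
      fun x => by ring
    simp only [e1] at h4
    rw [integral_sub (int η hη hηc) ((int χ hχs hχc).const_mul _), integral_const_mul] at h4
    simp only [smul_eq_mul, mul_sub]
    rw [integral_sub (int η hη hηc) (hηi.mul_const _), integral_mul_const]
    exact h4
  filter_upwards [key] with x hx using sub_eq_zero.1 hx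

/-- A locally integrable function with a continuous weak derivative is almost everywhere equal to
a primitive of it. -/
theorem exists_hasDerivAt_of_weakDeriv {g h : ℝ → ℝ} (hg : LocallyIntegrable g)
    (hh : Continuous h)
    (hw : ∀ ψ : ℝ → ℝ, ContDiff ℝ ∞ ψ → HasCompactSupport ψ →
      ∫ x, deriv ψ x * g x = - ∫ x, ψ x * h x) :
    ∃ G : ℝ → ℝ, (∀ x, HasDerivAt G (h x) x) ∧ g =ᵐ[volume] G := by
  have hd : ∀ x, HasDerivAt (fun x => ∫ t in (0 : ℝ)..x, h t) (h x) x := fun x =>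
    intervalIntegral.integral_hasDerivAt_right (hh.intervalIntegrable _ _)
      (hh.stronglyMeasurableAtFilter _ _) hh.continuousAt
  set H : ℝ → ℝ := fun x => ∫ t in (0 : ℝ)..x, h t
  have hHc : Continuous H := continuous_iff_continuousAt.2 fun x => (hd x).continuousAt
  obtain ⟨c, hc⟩ := ae_eq_const_of_integral_deriv_mul_eq_zero
    (hg.sub hHc.locallyIntegrable) fun ψ hψ hψc => by
    have hψ' : Continuous (deriv ψ) := hψ.continuous_deriv (by simp)
    have hψd : ∀ x, HasDerivAt ψ (deriv ψ x) x := fun x =>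
      (hψ.differentiable (by simp) x).hasDerivAt
    have ibp : ∫ x, deriv ψ x * H x = - ∫ x, ψ x * h x := by
      simp only [mul_comm (deriv ψ _), mul_comm (ψ _)]
      refine integral_mul_deriv_eq_deriv_mul_of_integrable (u := H) (v := ψ)
        (fun x _ => hd x) (fun x _ => hψd x) ?_ ?_ ?_
      · exact (hHc.mul hψ').integrable_of_hasCompactSupport hψc.deriv.mul_left
      · exact (hh.mul hψ.continuous).integrable_of_hasCompactSupport hψc.mul_left
      · exact (hHc.mul hψ.continuous).integrable_of_hasCompactSupport hψc.mul_left
    simp only [Pi.sub_apply, mul_sub]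
    rw [integral_sub, hw ψ hψ hψc, ibp, sub_self]
    · exact hg.integrable_smul_left_of_hasCompactSupport hψ' hψc.deriv
    · exact (hψ'.mul hHc).integrable_of_hasCompactSupport hψc.deriv.mul_right
  refine ⟨fun x => H x + c, fun x => (hd x).add_const c, ?_⟩
  filter_upwards [hc] with x hx
  simp only [Pi.sub_apply] at hx
  linarith

theorem HasWeakDeriv.integral_re {u v : ℝ → ℂ} (h : HasWeakDeriv u v) {ψ : ℝ → ℝ}
    (hψ : ContDiff ℝ ∞ ψ) (hc : HasCompactSupport ψ) :
    ∫ x, deriv ψ x * (u x).re = - ∫ x, ψ x * (v x).re := by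
  have h1 := h.1.integrable_smul_left_of_hasCompactSupport
    (hψ.continuous_deriv (by simp)) hc.deriv
  have h2 := h.2.1.integrable_smul_left_of_hasCompactSupport hψ.continuous hc
  have := congrArg Complex.re (h.2.2 ψ hψ hc)
  rw [Complex.neg_re] at this
  have e1 := _root_.integral_re h1
  have e2 := _root_.integral_re h2
  simp only [RCLike.re_to_complex, Complex.smul_re, smul_eq_mul] at e1 e2
  rw [e1, e2]
  exact this

theorem HasWeakDeriv.integral_im {u v : ℝ → ℂ} (h : HasWeakDeriv u v) {ψ : ℝ → ℝ}
    (hψ : ContDiff ℝ ∞ ψ) (hc : HasCompactSupport ψ) :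
    ∫ x, deriv ψ x * (u x).im = - ∫ x, ψ x * (v x).im := by
  have h1 := h.1.integrable_smul_left_of_hasCompactSupport
    (hψ.continuous_deriv (by simp)) hc.deriv
  have h2 := h.2.1.integrable_smul_left_of_hasCompactSupport hψ.continuous hc
  have := congrArg Complex.im (h.2.2 ψ hψ hc)
  rw [Complex.neg_im] at this
  have e1 := _root_.integral_im h1
  have e2 := _root_.integral_im h2
  simp only [RCLike.im_to_complex, Complex.smul_im, smul_eq_mul] at e1 e2
  rw [e1, e2]
  exact this

theorem locallyIntegrable_re {u : ℝ → ℂ} (h : LocallyIntegrable u) :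
    LocallyIntegrable fun x => (u x).re := fun x => by
  obtain ⟨s, hs, hi⟩ := h x
  exact ⟨s, hs, hi.re⟩

theorem locallyIntegrable_im {u : ℝ → ℂ} (h : LocallyIntegrable u) :
    LocallyIntegrable fun x => (u x).im := fun x => by
  obtain ⟨s, hs, hi⟩ := h x
  exact ⟨s, hs, hi.im⟩

/-- The factor τ absorbs the jump of σ; this form makes the continuity visible. -/
theorem step_mul_self_eq (a : ℝ) : (fun τ => step a τ * τ) = fun τ => max τ 0 + a * min τ 0 := by
  ext τ
  unfold step
  split_ifs with h
  · rw [max_eq_left h.le, min_eq_right h.le]; ring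
  · rw [max_eq_right (not_lt.1 h), min_eq_left (not_lt.1 h)]; ring

theorem continuous_potential (a ξ : ℝ) : Continuous (potential a ξ) := by
  unfold potential
  have := step_mul_self_eq a
  have h : Continuous fun τ => step a τ * τ := by rw [this]; fun_prop
  fun_prop

/-- Elliptic regularity: the ground state is twice continuously differentiable and solves the
eigenvalue equation in the classical sense; its classical derivative is its weak derivative. -/
theorem IsGroundState.exists_deriv {a ξ : ℝ} {φ : ℝ → ℝ} (h : IsGroundState a ξ φ) :
    ∃ φ' : ℝ → ℝ, (∀ x, HasDerivAt φ (φ' x) x) ∧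
      (∀ x, HasDerivAt φ' ((potential a ξ x - bandFun a ξ) * φ x) x) ∧
      ∃ v, MemB1 (fun x => (φ x : ℂ)) v ∧ ∀ᵐ x, v x = (φ' x : ℂ) := by
  obtain ⟨-, v, w, hB, hw, heq⟩ := h.eigen
  have hV := continuous_potential a ξ
  have hφ := h.continuous
  have hwre : ∀ᵐ x, (w x).re = (potential a ξ x - bandFun a ξ) * φ x := by
    filter_upwards [heq] with x hx
    have := congrArg Complex.re hx
    simp only [Complex.add_re, Complex.neg_re, Complex.smul_re, Complex.ofReal_re,
      smul_eq_mul] at this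
    linarith
  obtain ⟨G, hG, hvG⟩ := exists_hasDerivAt_of_weakDeriv
    (h := fun x => (potential a ξ x - bandFun a ξ) * φ x)
    (locallyIntegrable_re hw.1) (by fun_prop) fun ψ hψ hc => by
    rw [hw.integral_re hψ hc]
    congr 1
    refine integral_congr_ae ?_
    filter_upwards [hwre] with x hx
    rw [hx]
  have hGc : Continuous G := continuous_iff_continuousAt.2 fun x => (hG x).continuousAt
  obtain ⟨F, hF, hφF⟩ := exists_hasDerivAt_of_weakDeriv (g := φ) (h := G)
    hφ.locallyIntegrable hGc fun ψ hψ hc => by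
    have := hB.hasWeakDeriv.integral_re hψ hc
    simp only [Complex.ofReal_re] at this
    rw [this]
    congr 1
    refine integral_congr_ae ?_
    filter_upwards [hvG] with x hx
    rw [hx]
  have hFc : Continuous F := continuous_iff_continuousAt.2 fun x => (hF x).continuousAt
  obtain rfl : φ = F := (hφ.ae_eq_iff_eq volume hFc).1 hφF
  refine ⟨G, hF, hG, v, hB, ?_⟩
  -- The imaginary part of v is the weak derivative of Im φ = 0.
  have him : ∀ᵐ x, (v x).im = 0 := by
    refine ae_eq_zero_of_integral_contDiff_smul_eq_zero
      (locallyIntegrable_im hB.hasWeakDeriv.2.1) fun ψ hψ hc => ?_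
    have := hB.hasWeakDeriv.integral_im hψ hc
    simp only [Complex.ofReal_im, mul_zero, integral_zero] at this
    simp only [smul_eq_mul]
    linarith
  filter_upwards [hvG, him] with x h1 h2
  apply Complex.ext <;> simp [h1, h2]

/-! ### Half-line states and their exponential decay -/

open Filter Asymptotics Set Polynomial

/-- `f` is a positive square integrable solution of `-f'' + (ζ + k x)² f = μ f` on the half-line
`[0, ∞)`, with square integrable derivative `f'`. -/
structure IsHalfLineState (k ζ μ : ℝ) (f f' : ℝ → ℝ) : Prop where
  slope_pos : 0 < k
  pos : ∀ x, 0 ≤ x → 0 < f x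
  hasDerivAt : ∀ x, 0 ≤ x → HasDerivAt f (f' x) x
  hasDerivAt_deriv : ∀ x, 0 ≤ x → HasDerivAt f' (((ζ + k * x) ^ 2 - μ) * f x) x
  integrableOn_sq : IntegrableOn (fun x => f x ^ 2) (Ioi 0)
  integrableOn_deriv_sq : IntegrableOn (fun x => f' x ^ 2) (Ioi 0)

theorem not_integrableOn_Ioi_of_le {g : ℝ → ℝ} {c t : ℝ} (hc : 0 < c)
    (h : ∀ x, t < x → c ≤ g x) : ¬ IntegrableOn g (Ioi t) := by
  intro hg
  have : IntegrableOn (fun _ : ℝ => c) (Ioi t) := by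
    refine Integrable.mono' hg aestronglyMeasurable_const ?_
    refine (ae_restrict_iff' measurableSet_Ioi).2 (Eventually.of_forall fun x hx => ?_)
    rw [Real.norm_of_nonneg hc.le]
    exact h x hx
  rw [integrableOn_const_iff] at this
  simp [hc.ne'] at this

namespace IsHalfLineState

variable {k ζ μ : ℝ} {f f' : ℝ → ℝ}

theorem continuousOn (h : IsHalfLineState k ζ μ f f') : ContinuousOn f (Ici 0) := fun x hx =>
  (h.hasDerivAt x hx).continuousAt.continuousWithinAt

theorem exists_one_le_potential (h : IsHalfLineState k ζ μ f f') :
    ∃ T, 0 ≤ T ∧ ∀ x, T ≤ x → 1 ≤ (ζ + k * x) ^ 2 - μ := by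
  have h1 : Tendsto (fun x : ℝ => ζ + k * x) atTop atTop :=
    tendsto_atTop_add_const_left _ _ (tendsto_id.const_mul_atTop h.slope_pos)
  have h2 : Tendsto (fun x : ℝ => (ζ + k * x) ^ 2) atTop atTop :=
    (tendsto_pow_atTop two_ne_zero).comp h1
  obtain ⟨T, hT⟩ := eventually_atTop.1 (h2.eventually_ge_atTop (1 + μ))
  exact ⟨max T 0, le_max_right _ _, fun x hx => by
    linarith [hT x ((le_max_left _ _).trans hx)]⟩

/-- Where the potential exceeds the energy by 1, a solution with f' + f > 0 at one point keeps f' +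
f bounded below by that value from then on, which square integrability of f and f' excludes. -/
theorem deriv_add_self_nonpos (h : IsHalfLineState k ζ μ f f') {T : ℝ} (hT0 : 0 ≤ T)
    (hT : ∀ x, T ≤ x → 1 ≤ (ζ + k * x) ^ 2 - μ) {x₁ : ℝ} (hx₁ : T ≤ x₁) :
    f' x₁ + f x₁ ≤ 0 := by
  by_contra! hpos
  have hd : ∀ x, T ≤ x → HasDerivAt (fun x => Real.exp (-x) * (f' x + f x))
      (Real.exp (-x) * (((ζ + k * x) ^ 2 - μ - 1) * f x)) x := fun x hx => by
    have hx0 := hT0.trans hx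
    refine HasDerivAt.congr_deriv (((hasDerivAt_neg x).exp).mul
      ((h.hasDerivAt_deriv x hx0).add (h.hasDerivAt x hx0))) ?_
    ring
  have hmono : MonotoneOn (fun x => Real.exp (-x) * (f' x + f x)) (Ici T) := by
    refine monotoneOn_of_deriv_nonneg (convex_Ici T)
      (fun x hx => (hd x hx).continuousAt.continuousWithinAt)
      (fun x hx => (hd x (interior_subset hx)).differentiableAt.differentiableWithinAt)
      fun x hx => ?_
    have hx := interior_subset hx
    rw [(hd x hx).deriv]
    have := h.pos x (hT0.trans hx)
    have := hT x hx
    exact mul_nonneg (Real.exp_pos _).le (mul_nonneg (by linarith) (by linarith))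
  have hge : ∀ x, x₁ < x → f' x₁ + f x₁ ≤ f' x + f x := fun x hx => by
    have h1 := hmono (mem_Ici.2 hx₁) (mem_Ici.2 (hx₁.trans hx.le)) hx.le
    simp only at h1
    have h2 : Real.exp (-x) ≤ Real.exp (-x₁) := Real.exp_le_exp.2 (by linarith)
    have h3 : Real.exp (-x) * (f' x₁ + f x₁) ≤ Real.exp (-x) * (f' x + f x) :=
      (mul_le_mul_of_nonneg_right h2 hpos.le).trans h1
    exact le_of_mul_le_mul_left h3 (Real.exp_pos _)
  refine not_integrableOn_Ioi_of_le (g := fun x => 2 * f' x ^ 2 + 2 * f x ^ 2) (t := x₁)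
    (pow_pos hpos 2) (fun x hx => ?_) ?_
  · have := hge x hx
    nlinarith [sq_nonneg (f' x - f x)]
  · exact IntegrableOn.mono_set
      ((h.integrableOn_deriv_sq.const_mul 2).add (h.integrableOn_sq.const_mul 2))
      (Ioi_subset_Ioi (hT0.trans hx₁))

/-- The inequality f' + f ≤ 0 says that eˣ f decreases, which bounds f. Since f is eventually convex
and decreasing, |f'(x)| is at most the drop of f over [x - 1, x]. -/
theorem isBigO (h : IsHalfLineState k ζ μ f f') :
    f =O[atTop] (fun x => Real.exp (-x)) ∧ f' =O[atTop] fun x => Real.exp (-x) := by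
  obtain ⟨T, hT0, hT⟩ := h.exists_one_le_potential
  have hle := fun x hx => h.deriv_add_self_nonpos hT0 hT (x₁ := x) hx
  have hd : ∀ x, T ≤ x → HasDerivAt (fun x => Real.exp x * f x)
      (Real.exp x * (f' x + f x)) x := fun x hx => by
    refine HasDerivAt.congr_deriv ((Real.hasDerivAt_exp x).mul (h.hasDerivAt x (hT0.trans hx))) ?_
    ring
  have hanti : AntitoneOn (fun x => Real.exp x * f x) (Ici T) := by
    refine antitoneOn_of_deriv_nonpos (convex_Ici T)
      (fun x hx => (hd x hx).continuousAt.continuousWithinAt)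
      (fun x hx => (hd x (interior_subset hx)).differentiableAt.differentiableWithinAt)
      fun x hx => ?_
    have hx := interior_subset hx
    rw [(hd x hx).deriv]
    exact mul_nonpos_of_nonneg_of_nonpos (Real.exp_pos _).le (hle x hx)
  set C := Real.exp T * f T
  have hC : 0 < C := mul_pos (Real.exp_pos _) (h.pos T hT0)
  have hf : ∀ x, T ≤ x → f x ≤ C * Real.exp (-x) := fun x hx => by
    have := hanti self_mem_Ici (mem_Ici.2 hx) hx
    simp only at this
    rw [Real.exp_neg, ← div_eq_mul_inv, le_div_iff₀ (Real.exp_pos _), mul_comm]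
    exact this
  have hmono : MonotoneOn f' (Ici T) := by
    refine monotoneOn_of_deriv_nonneg (convex_Ici T)
      (fun x hx => (h.hasDerivAt_deriv x (hT0.trans hx)).continuousAt.continuousWithinAt)
      (fun x hx => (h.hasDerivAt_deriv x
        (hT0.trans (interior_subset hx))).differentiableAt.differentiableWithinAt)
      fun x hx => ?_
    have hx := interior_subset hx
    have h1 := h.pos x (hT0.trans hx)
    have h2 := hT x hx
    rw [(h.hasDerivAt_deriv x (hT0.trans hx)).deriv]
    exact mul_nonneg (by linarith) h1.le
  refine ⟨IsBigO.of_bound C ?_, IsBigO.of_bound (C * Real.exp 1) ?_⟩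
  · filter_upwards [eventually_ge_atTop T] with x hx
    rw [Real.norm_of_nonneg (h.pos x (hT0.trans hx)).le, Real.norm_of_nonneg (Real.exp_pos _).le]
    exact hf x hx
  · filter_upwards [eventually_ge_atTop (T + 1)] with x hx
    have hx' : T ≤ x := by linarith
    have hneg : f' x ≤ 0 := by linarith [hle x hx', h.pos x (hT0.trans hx')]
    rw [Real.norm_of_nonpos hneg, Real.norm_of_nonneg (Real.exp_pos _).le]
    obtain ⟨c, ⟨hc1, hc2⟩, hc⟩ := exists_hasDerivAt_eq_slope f f' (a := x - 1) (b := x)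
      (by linarith)
      (fun y hy => (h.hasDerivAt y (by linarith [hy.1])).continuousAt.continuousWithinAt)
      (fun y hy => h.hasDerivAt y (by linarith [hy.1]))
    have h1 := hmono (mem_Ici.2 (by linarith)) (mem_Ici.2 hx') hc2.le
    rw [sub_sub_cancel, div_one] at hc
    have h2 := hf (x - 1) (by linarith)
    have h3 : Real.exp (-(x - 1)) = Real.exp 1 * Real.exp (-x) := by
      rw [← Real.exp_add]; ring_nf
    rw [h3] at h2
    linarith [h.pos x (hT0.trans hx')]

end IsHalfLineState

/-- A polynomial costs at most eˣ, and one of the two decaying factors pays for it. -/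
theorem isBigO_eval_mul_mul (P : ℝ[X]) {g₁ g₂ : ℝ → ℝ}
    (h₁ : g₁ =O[atTop] fun x => Real.exp (-x)) (h₂ : g₂ =O[atTop] fun x => Real.exp (-x)) :
    (fun x => P.eval x * (g₁ x * g₂ x)) =O[atTop] fun x => Real.exp (-x) := by
  have hP : (fun x => P.eval x) =O[atTop] Real.exp := by
    have h1 := Polynomial.isBigO_atTop_of_degree_le P (X ^ P.natDegree)
      (by rw [degree_X_pow]; exact degree_le_natDegree)
    simp only [eval_pow, eval_X] at h1
    exact h1.trans Real.isLittleO_pow_exp_atTop.isBigO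
  refine (hP.mul (h₁.mul h₂)).congr_right fun x => ?_
  rw [← Real.exp_add, ← Real.exp_add]
  ring_nf

theorem tendsto_eval_mul_mul (P : ℝ[X]) {g₁ g₂ : ℝ → ℝ}
    (h₁ : g₁ =O[atTop] fun x => Real.exp (-x)) (h₂ : g₂ =O[atTop] fun x => Real.exp (-x)) :
    Tendsto (fun x => P.eval x * (g₁ x * g₂ x)) atTop (nhds 0) :=
  (isBigO_eval_mul_mul P h₁ h₂).trans_tendsto Real.tendsto_exp_neg_atTop_nhds_zero

theorem integrableOn_eval_mul_mul (P : ℝ[X]) {g₁ g₂ : ℝ → ℝ}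
    (h₁ : g₁ =O[atTop] fun x => Real.exp (-x)) (h₂ : g₂ =O[atTop] fun x => Real.exp (-x))
    (hc₁ : ContinuousOn g₁ (Ici 0)) (hc₂ : ContinuousOn g₂ (Ici 0)) :
    IntegrableOn (fun x => P.eval x * (g₁ x * g₂ x)) (Ioi 0) :=
  integrable_of_isBigO_exp_neg one_pos (P.continuous.continuousOn.mul (hc₁.mul hc₂))
    (by simpa using isBigO_eval_mul_mul P h₁ h₂)

namespace IsHalfLineState

variable {k ζ μ : ℝ} {f f' : ℝ → ℝ}

theorem integrableOn_eval_mul_sq (h : IsHalfLineState k ζ μ f f') (P : ℝ[X]) :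
    IntegrableOn (fun x => P.eval x * f x ^ 2) (Ioi 0) := by
  simpa only [pow_two] using
    integrableOn_eval_mul_mul P h.isBigO.1 h.isBigO.1 h.continuousOn h.continuousOn

theorem integrableOn_pow_mul_sq (h : IsHalfLineState k ζ μ f f') (n : ℕ) :
    IntegrableOn (fun x => (ζ + k * x) ^ n * f x ^ 2) (Ioi 0) := by
  refine (h.integrableOn_eval_mul_sq ((C ζ + C k * X) ^ n)).congr_fun (fun x _ => ?_)
    measurableSet_Ioi
  simp only [eval_pow, eval_add, eval_mul, eval_C, eval_X]

/-! ### Energy and virial identities, half-line moments -/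

/-- The energy identity on the half-line. -/
theorem integral_energy (h : IsHalfLineState k ζ μ f f') :
    ∫ x in Ioi 0, (f' x ^ 2 + ((ζ + k * x) ^ 2 - μ) * f x ^ 2) = - (f 0 * f' 0) := by
  have key := integral_Ioi_of_hasDerivAt_of_tendsto' (a := 0) (f := fun x => f x * f' x)
    (f' := fun x => f' x ^ 2 + ((ζ + k * x) ^ 2 - μ) * f x ^ 2) (m := 0) (fun x hx => by
      refine HasDerivAt.congr_deriv ((h.hasDerivAt x hx).mul (h.hasDerivAt_deriv x hx)) ?_
      ring) ?_ ?_
  · rw [key, zero_sub]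
  · refine h.integrableOn_deriv_sq.add ?_
    refine (h.integrableOn_eval_mul_sq ((C ζ + C k * X) ^ 2 - C μ)).congr_fun (fun x _ => ?_)
      measurableSet_Ioi
    simp only [eval_sub, eval_pow, eval_add, eval_mul, eval_C, eval_X]
  · simpa using tendsto_eval_mul_mul 1 h.isBigO.1 h.isBigO.2

/-- The virial identity with polynomial multiplier `P` on the half-line. -/
theorem integral_virial (h : IsHalfLineState k ζ μ f f') (P : ℝ[X]) :
    ∫ x in Ioi 0, (-2 * P.derivative.eval x * ((ζ + k * x) ^ 2 - μ)
        - P.eval x * (2 * k * (ζ + k * x))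
        + P.derivative.derivative.derivative.eval x / 2) * f x ^ 2 =
      - (P.eval 0 * f' 0 ^ 2 - P.eval 0 * (ζ ^ 2 - μ) * f 0 ^ 2
        - P.derivative.eval 0 * (f 0 * f' 0)
        + P.derivative.derivative.eval 0 / 2 * f 0 ^ 2) := by
  obtain ⟨O1, O2⟩ := h.isBigO
  -- The first two terms of this primitive come from the multiplier P f'; the terms in P' and P''
  -- are added to cancel f'² and f f' in the derivative, so that only multiples of f² remain.
  have key := integral_Ioi_of_hasDerivAt_of_tendsto' (a := 0)
    (f := fun x => P.eval x * f' x ^ 2 - P.eval x * ((ζ + k * x) ^ 2 - μ) * f x ^ 2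
        - P.derivative.eval x * (f x * f' x) + P.derivative.derivative.eval x / 2 * f x ^ 2)
    (f' := fun x => (-2 * P.derivative.eval x * ((ζ + k * x) ^ 2 - μ)
        - P.eval x * (2 * k * (ζ + k * x))
        + P.derivative.derivative.derivative.eval x / 2) * f x ^ 2) (m := 0) (fun x hx => by
      have d0 := h.hasDerivAt x hx
      have d1 := h.hasDerivAt_deriv x hx
      have dV : HasDerivAt (fun x => (ζ + k * x) ^ 2 - μ) (2 * k * (ζ + k * x)) x := by
        refine HasDerivAt.congr_deriv
          (((((hasDerivAt_id x).const_mul k).const_add ζ).pow 2).sub_const μ) ?_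
        simp
        ring
      refine HasDerivAt.congr_deriv (((((P.hasDerivAt x).mul (d1.pow 2)).sub
        (((P.hasDerivAt x).mul dV).mul (d0.pow 2))).sub
        ((P.derivative.hasDerivAt x).mul (d0.mul d1))).add
        (((P.derivative.derivative.hasDerivAt x).div_const 2).mul (d0.pow 2))) ?_
      simp only [Pi.mul_apply, Pi.pow_apply]
      push_cast
      ring) ?_ ?_
  · rw [key]; simp
  · have := h.integrableOn_eval_mul_sq (-2 * P.derivative * ((C ζ + C k * X) ^ 2 - C μ)
      - P * (2 * C k * (C ζ + C k * X)) + C (1 / 2) * P.derivative.derivative.derivative)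
    refine this.congr_fun (fun x _ => ?_) measurableSet_Ioi
    simp [-mul_eq_mul_right_iff]
    ring
  · have t1 := tendsto_eval_mul_mul P O2 O2
    have t2 := tendsto_eval_mul_mul (P * ((C ζ + C k * X) ^ 2 - C μ)) O1 O1
    have t3 := tendsto_eval_mul_mul P.derivative O1 O2
    have t4 := tendsto_eval_mul_mul (C (1 / 2) * P.derivative.derivative) O1 O1
    have := ((t1.sub t2).sub t3).add t4
    simp only [sub_zero, add_zero] at this
    refine this.congr fun x => ?_
    simp
    ring

/-- Virial identity with P = 1. -/
theorem moment_one (h : IsHalfLineState k ζ μ f f') :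
    2 * k * ∫ x in Ioi 0, (ζ + k * x) * f x ^ 2 = f' 0 ^ 2 + (μ - ζ ^ 2) * f 0 ^ 2 := by
  have := h.integral_virial 1
  simp only [derivative_one, eval_one, eval_zero, derivative_zero] at this
  rw [← integral_const_mul, ← neg_inj, ← integral_neg]
  convert this using 1
  · congr 1; ext x; ring
  · ring

/-- Virial identity with P = ζ + kx. -/
theorem moment_two (h : IsHalfLineState k ζ μ f f') :
    4 * k * (∫ x in Ioi 0, (ζ + k * x) ^ 2 * f x ^ 2) - 2 * k * μ * (∫ x in Ioi 0, f x ^ 2) =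
      ζ * (f' 0 ^ 2 + (μ - ζ ^ 2) * f 0 ^ 2) - k * (f 0 * f' 0) := by
  have := h.integral_virial (C ζ + C k * X)
  simp at this
  rw [← integral_const_mul, ← integral_const_mul, ← integral_sub
    ((h.integrableOn_pow_mul_sq 2).const_mul _) (h.integrableOn_sq.const_mul _), ← neg_inj,
    ← integral_neg]
  convert this using 1
  · congr 1; ext x; ring
  · ring

/-- Virial identity with P = (ζ + kx)²; its nonzero second derivative contributes the term k² f(0)².
-/
theorem moment_three (h : IsHalfLineState k ζ μ f f') :
    k * (6 * (∫ x in Ioi 0, (ζ + k * x) ^ 3 * f x ^ 2)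
        - 4 * μ * ∫ x in Ioi 0, (ζ + k * x) * f x ^ 2) =
      ζ ^ 2 * (f' 0 ^ 2 + (μ - ζ ^ 2) * f 0 ^ 2) - 2 * k * ζ * (f 0 * f' 0)
        + k ^ 2 * f 0 ^ 2 := by
  have := h.integral_virial ((C ζ + C k * X) ^ 2)
  simp [derivative_pow] at this
  rw [← integral_const_mul, ← integral_const_mul, ← integral_sub
    ((h.integrableOn_pow_mul_sq 3).const_mul _)
    ((by simpa using h.integrableOn_pow_mul_sq 1 :
      IntegrableOn (fun x => (ζ + k * x) * f x ^ 2) (Ioi 0)).const_mul _),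
    ← integral_const_mul, ← neg_inj, ← integral_neg]
  convert this using 1
  · congr 1; ext x; ring
  · ring

end IsHalfLineState

/-! ### Gluing the two half-lines -/

theorem integrable_of_integrableOn_comp_neg {g : ℝ → ℝ} (h₁ : IntegrableOn g (Ioi 0))
    (h₂ : IntegrableOn (fun x => g (-x)) (Ioi 0)) : Integrable g := by
  have h3 : IntegrableOn g (Iic 0) := by
    rw [integrableOn_Iic_iff_integrableOn_Iio]
    have := (Measure.measurePreserving_neg (volume : Measure ℝ)).integrableOn_comp_preimage
      (Homeomorph.neg ℝ).measurableEmbedding (f := g) (s := Iio 0)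
    rw [← this]
    simpa [Function.comp_def] using h₂
  rw [← integrableOn_univ, ← Iic_union_Ioi (a := (0 : ℝ))]
  exact h3.union h₁

theorem integral_eq_add_integral_comp_neg {g : ℝ → ℝ} (h₁ : IntegrableOn g (Ioi 0))
    (h₂ : IntegrableOn (fun x => g (-x)) (Ioi 0)) :
    ∫ x, g x = (∫ x in Ioi 0, g x) + ∫ x in Ioi 0, g (-x) := by
  have hg := integrable_of_integrableOn_comp_neg h₁ h₂
  rw [integral_comp_neg_Ioi, neg_zero, add_comm,
    intervalIntegral.integral_Iic_add_Ioi hg.integrableOn hg.integrableOn]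

/-! ### Sturm comparison and the sign of the slope at 0 -/

theorem IsHalfLineState.tendsto {k ζ μ : ℝ} {f f' : ℝ → ℝ} (h : IsHalfLineState k ζ μ f f') :
    Tendsto f atTop (nhds 0) ∧ Tendsto f' atTop (nhds 0) :=
  ⟨h.isBigO.1.trans_tendsto Real.tendsto_exp_neg_atTop_nhds_zero,
    h.isBigO.2.trans_tendsto Real.tendsto_exp_neg_atTop_nhds_zero⟩

/-- If `g'² + (μ - ζ²) g²` vanishes at `0` and `g' 0 ≤ 0`, then `g'` is negative as long as
`ζ + k y < 0`. -/
theorem IsHalfLineState.deriv_neg {k ζ μ : ℝ} {g g' : ℝ → ℝ} (h : IsHalfLineState k ζ μ g g')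
    (h0 : g' 0 ^ 2 + (μ - ζ ^ 2) * g 0 ^ 2 = 0) (h0' : g' 0 ≤ 0) {y₀ : ℝ} (hy₀ : 0 < y₀)
    (hζ : ζ + k * y₀ < 0) : g' y₀ < 0 := by
  have hk := h.slope_pos
  have dF : ∀ x, 0 ≤ x → HasDerivAt (fun x => g' x ^ 2 + (μ - (ζ + k * x) ^ 2) * g x ^ 2)
      (-(2 * k * (ζ + k * x)) * g x ^ 2) x := fun x hx => by
    have dV : HasDerivAt (fun x => μ - (ζ + k * x) ^ 2) (-(2 * k * (ζ + k * x))) x := by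
      refine HasDerivAt.congr_deriv
        (((((hasDerivAt_id x).const_mul k).const_add ζ).pow 2).const_sub μ) ?_
      simp
      ring
    refine HasDerivAt.congr_deriv
      (((h.hasDerivAt_deriv x hx).pow 2).add (dV.mul ((h.hasDerivAt x hx).pow 2))) ?_
    push_cast
    ring
  -- The derivative -2k(ζ + kx) g² is positive before the well, so this quantity leaves its initial
  -- value 0 upwards.
  have hF : StrictMonoOn (fun x => g' x ^ 2 + (μ - (ζ + k * x) ^ 2) * g x ^ 2) (Icc 0 y₀) := by
    refine strictMonoOn_of_deriv_pos (convex_Icc 0 y₀)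
      (fun x hx => (dF x hx.1).continuousAt.continuousWithinAt) fun x hx => ?_
    rw [interior_Icc] at hx
    rw [(dF x hx.1.le).deriv]
    have h1 : k * x < k * y₀ := mul_lt_mul_of_pos_left hx.2 hk
    have h2 := h.pos x hx.1.le
    exact mul_pos (by nlinarith) (pow_pos h2 2)
  -- Riccati equation: the logarithmic derivative decreases exactly at the rate of the quantity
  -- above divided by g².
  have dR : ∀ x, 0 ≤ x → HasDerivAt (fun x => g' x / g x)
      (-(g' x ^ 2 + (μ - (ζ + k * x) ^ 2) * g x ^ 2) / g x ^ 2) x := fun x hx => by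
    refine HasDerivAt.congr_deriv
      ((h.hasDerivAt_deriv x hx).div (h.hasDerivAt x hx) (h.pos x hx).ne') ?_
    ring
  have hR : StrictAntiOn (fun x => g' x / g x) (Icc 0 y₀) := by
    refine strictAntiOn_of_deriv_neg (convex_Icc 0 y₀)
      (fun x hx => (dR x hx.1).continuousAt.continuousWithinAt) fun x hx => ?_
    rw [interior_Icc] at hx
    rw [(dR x hx.1.le).deriv]
    have h1 := hF (left_mem_Icc.2 hy₀.le) (Ioo_subset_Icc_self hx) hx.1
    simp only [mul_zero, add_zero, h0] at h1
    exact div_neg_of_neg_of_pos (neg_neg_of_pos h1) (pow_pos (h.pos x hx.1.le) 2)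
  have h1 := hR (left_mem_Icc.2 hy₀.le) (right_mem_Icc.2 hy₀.le) hy₀
  have h2 : g' 0 / g 0 ≤ 0 := div_nonpos_of_nonpos_of_nonneg h0' (h.pos 0 le_rfl).le
  have h3 := h1.trans_le h2
  rwa [div_lt_iff₀ (h.pos y₀ hy₀.le), zero_mul] at h3

/-- Sturm comparison of two half-line states with the same energy, the second one with a flatter
potential. -/
theorem IsHalfLineState.deriv_zero_neg_of_slope_lt_one {k ζ μ : ℝ} {f f' g g' : ℝ → ℝ}
    (hf : IsHalfLineState 1 ζ μ f f') (hg : IsHalfLineState k ζ μ g g') (hk : k < 1)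
    (hζ : ζ < 0) (hμ : 0 ≤ μ) (h0 : g' 0 ^ 2 + (μ - ζ ^ 2) * g 0 ^ 2 = 0) (h0' : g' 0 ≤ 0) :
    f' 0 < 0 := by
  by_contra! hcon
  have hk0 := hg.slope_pos
  obtain ⟨d, hd1, hkd⟩ : ∃ d : ℝ, 1 < d ∧ k * d ^ 2 = 1 := by
    have h1 : 0 < √k := Real.sqrt_pos.2 hk0
    have h2 : √k < 1 := by rw [Real.sqrt_lt' one_pos]; simpa using hk
    refine ⟨(√k)⁻¹, (one_lt_inv₀ h1).2 h2, ?_⟩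
    rw [inv_pow, Real.sq_sqrt hk0.le, mul_inv_cancel₀ hk0.ne']
  have hd0 : 0 < d := one_pos.trans hd1
  -- The scale d and shift y₀ make x ↦ g(dx + y₀) a solution with potential (ζ + x)², the one of f,
  -- and energy d²μ ≥ μ. The point y₀ lies before the well of g.
  set y₀ : ℝ := -ζ * (d * (d - 1)) with hy₀
  have hy₀0 : 0 < y₀ := mul_pos (by linarith) (mul_pos hd0 (by linarith))
  have hpt : ∀ x, d * (ζ + k * (d * x + y₀)) = ζ + x := fun x => by
    have : d * (ζ + k * (d * x + y₀)) = d * ζ + k * d ^ 2 * (x - ζ * (d - 1)) := by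
      rw [hy₀]; ring
    rw [this, hkd]; ring
  have hgy : g' y₀ < 0 := by
    refine hg.deriv_neg h0 h0' hy₀0 ?_
    have := hpt 0
    rw [mul_zero, zero_add, add_zero] at this
    by_contra! h
    have := mul_nonneg hd0.le h
    linarith
  have haff : ∀ x, 0 ≤ x → 0 ≤ d * x + y₀ := fun x hx => by positivity
  have daff : ∀ x, HasDerivAt (fun x => d * x + y₀) d x := fun x => by
    simpa using ((hasDerivAt_id x).const_mul d).add_const y₀
  have dW : ∀ x, 0 ≤ x → HasDerivAt
      (fun x => f' x * g (d * x + y₀) - f x * (d * g' (d * x + y₀)))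
      ((d ^ 2 - 1) * μ * (f x * g (d * x + y₀))) x := fun x hx => by
    have e1 := (hg.hasDerivAt _ (haff x hx)).comp x (daff x)
    have e2 := ((hg.hasDerivAt_deriv _ (haff x hx)).comp x (daff x)).const_mul d
    refine HasDerivAt.congr_deriv (((hf.hasDerivAt_deriv x hx).mul e1).sub
      ((hf.hasDerivAt x hx).mul e2)) ?_
    have := hpt x
    simp only [Function.comp_apply, one_mul]
    rw [← this]
    ring
  have hmono : MonotoneOn (fun x => f' x * g (d * x + y₀) - f x * (d * g' (d * x + y₀)))
      (Ici 0) := by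
    refine monotoneOn_of_deriv_nonneg (convex_Ici 0)
      (fun x hx => (dW x hx).continuousAt.continuousWithinAt)
      (fun x hx => (dW x (interior_subset hx)).differentiableAt.differentiableWithinAt)
      fun x hx => ?_
    have hx := interior_subset hx
    rw [(dW x hx).deriv]
    exact mul_nonneg (mul_nonneg (by nlinarith) hμ)
      (mul_pos (hf.pos x hx) (hg.pos _ (haff x hx))).le
  have hlim : Tendsto (fun x => f' x * g (d * x + y₀) - f x * (d * g' (d * x + y₀)))
      atTop (nhds 0) := by
    have ht : Tendsto (fun x => d * x + y₀) atTop atTop :=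
      tendsto_atTop_add_const_right _ _ (tendsto_id.const_mul_atTop hd0)
    have := (hf.tendsto.2.mul (hg.tendsto.1.comp ht)).sub
      (hf.tendsto.1.mul ((hg.tendsto.2.comp ht).const_mul d))
    simpa using this
  -- The Wronskian increases to 0, so it is nonpositive at 0; f'(0) ≥ 0 and g'(y₀) < 0 would make it
  -- positive there.
  have hle := ge_of_tendsto hlim (b := f' 0 * g y₀ - f 0 * (d * g' y₀)) (by
    filter_upwards [eventually_ge_atTop 0] with x hx
    simpa using hmono self_mem_Ici (mem_Ici.2 hx) hx)
  have := mul_nonneg hcon (hg.pos y₀ hy₀0.le).le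
  have := mul_pos (hf.pos 0 le_rfl) (mul_pos hd0 (neg_pos.2 hgy))
  linarith

/-- For ζ ≥ 0 the integrand is positive; a vanishing first moment therefore forces ζ < 0. -/
theorem IsHalfLineState.moment_one_pos {k ζ μ : ℝ} {f f' : ℝ → ℝ}
    (h : IsHalfLineState k ζ μ f f') (hζ : 0 ≤ ζ) :
    0 < ∫ x in Ioi 0, (ζ + k * x) * f x ^ 2 := by
  have hpos : ∀ x ∈ Ioi (0 : ℝ), 0 < (ζ + k * x) * f x ^ 2 := fun x hx => by
    have := mul_pos h.slope_pos hx
    exact mul_pos (by linarith) (pow_pos (h.pos x (le_of_lt hx)) 2)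
  rw [setIntegral_pos_iff_support_of_nonneg_ae
    ((ae_restrict_iff' measurableSet_Ioi).2 (Eventually.of_forall fun x hx => (hpos x hx).le))
    (by simpa using h.integrableOn_pow_mul_sq 1)]
  have hsub : Ioi (0 : ℝ) ⊆ Function.support fun x => (ζ + k * x) * f x ^ 2 :=
    fun x hx => (hpos x hx).ne'
  rw [inter_eq_right.2 hsub, Real.volume_Ioi]
  exact ENNReal.zero_lt_top

/-! ### The band function as a variational bound -/

section Band

theorem potential_nonneg (a ξ τ : ℝ) : 0 ≤ potential a ξ τ := sq_nonneg _

theorem quadForm_nonneg (a ξ : ℝ) (u v : ℝ → ℂ) : 0 ≤ quadForm a ξ u v :=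
  integral_nonneg fun τ => by
    have := potential_nonneg a ξ τ
    simp only [Pi.zero_apply]
    positivity

theorem bandFun_nonneg (a ξ : ℝ) : 0 ≤ bandFun a ξ := by
  refine Real.sInf_nonneg ?_
  rintro r ⟨u, v, -, -, rfl⟩
  exact div_nonneg (quadForm_nonneg a ξ u v) (integral_nonneg fun _ => by positivity)

theorem bandFun_le {a ξ : ℝ} {u v : ℝ → ℂ} (h : MemB1 u v) (hu : ¬ u =ᵐ[volume] 0) :
    bandFun a ξ ≤ quadForm a ξ u v / ∫ τ, ‖u τ‖ ^ 2 := by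
  refine csInf_le ⟨0, ?_⟩ ⟨u, v, h, hu, rfl⟩
  rintro r ⟨u, v, -, -, rfl⟩
  exact div_nonneg (quadForm_nonneg a ξ u v) (integral_nonneg fun _ => by positivity)

theorem stepConst_le (a ξ : ℝ) : stepConst a ≤ bandFun a ξ := by
  refine ciInf_le ⟨0, ?_⟩ ξ
  rintro _ ⟨ξ, rfl⟩
  exact bandFun_nonneg a ξ

end Band

/-! ### Restriction to half-lines and stationarity at a minimizer -/

theorem step_of_pos {a x : ℝ} (hx : 0 < x) : step a x = 1 := if_pos hx

theorem step_neg_of_nonneg {a x : ℝ} (hx : 0 ≤ x) : step a (-x) = a :=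
  if_neg (by linarith)

theorem potential_of_nonneg {a ξ x : ℝ} (hx : 0 ≤ x) : potential a ξ x = (ξ + 1 * x) ^ 2 := by
  rcases hx.eq_or_lt with rfl | hx
  · simp [potential]
  · rw [potential, step_of_pos hx]

theorem potential_neg_of_nonneg {a ξ x : ℝ} (hx : 0 ≤ x) :
    potential a ξ (-x) = (ξ + -a * x) ^ 2 := by
  rw [potential, step_neg_of_nonneg hx]
  ring

/-- The restrictions of a ground state to the two half-lines. -/
theorem IsGroundState.exists_halfLine {a ζ : ℝ} (ha : a < 0) {φ : ℝ → ℝ}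
    (h : IsGroundState a ζ φ) :
    ∃ φ' : ℝ → ℝ, (∀ x, HasDerivAt φ (φ' x) x) ∧
      IsHalfLineState 1 ζ (bandFun a ζ) φ φ' ∧
      IsHalfLineState (-a) ζ (bandFun a ζ) (fun x => φ (-x)) (fun x => -φ' (-x)) ∧
      ∃ v, MemB1 (fun x => (φ x : ℂ)) v ∧ ∀ᵐ x, v x = (φ' x : ℂ) := by
  obtain ⟨φ', d, dd, v, hv, hvφ⟩ := h.exists_deriv
  have i0 : Integrable fun x => φ x ^ 2 := by
    have := hv.memLp.integrable_norm_pow two_ne_zero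
    simpa using this
  have i1 : Integrable fun x => φ' x ^ 2 := by
    have := hv.memLp_deriv.integrable_norm_pow two_ne_zero
    refine this.congr ?_
    filter_upwards [hvφ] with x hx
    simp [hx]
  refine ⟨φ', d, ⟨one_pos, fun x _ => h.pos x, fun x _ => d x, fun x hx => ?_, i0.integrableOn,
    i1.integrableOn⟩, ⟨by linarith, fun x _ => h.pos _, fun x _ => ?_, fun x hx => ?_,
    i0.comp_neg.integrableOn, ?_⟩, v, hv, hvφ⟩
  · rw [← potential_of_nonneg (a := a) hx]
    exact dd x
  · exact ((d (-x)).comp x (hasDerivAt_neg x)).congr_deriv (by ring)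
  · rw [← potential_neg_of_nonneg hx]
    exact ((dd (-x)).comp x (hasDerivAt_neg x)).neg.congr_deriv (by ring)
  · simpa only [neg_sq] using i1.comp_neg.integrableOn

/-- The stationarity of the band function at a minimizer (Feynman-Hellmann). -/
theorem IsGroundState.stationary {a ζ : ℝ}
    (hζ : bandFun a ζ = stepConst a) {φ φ' : ℝ → ℝ} (h : IsGroundState a ζ φ)
    (hr : IsHalfLineState 1 ζ (bandFun a ζ) φ φ')
    (hl : IsHalfLineState (-a) ζ (bandFun a ζ) (fun x => φ (-x)) (fun x => -φ' (-x)))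
    {v : ℝ → ℂ} (hv : MemB1 (fun x => (φ x : ℂ)) v) (hvφ : ∀ᵐ x, v x = (φ' x : ℂ)) :
    (∫ x in Ioi 0, (ζ + 1 * x) * φ x ^ 2) + ∫ x in Ioi 0, (ζ + -a * x) * φ (-x) ^ 2 = 0 := by
  set μ := bandFun a ζ
  have hne : ¬ (fun x => (φ x : ℂ)) =ᵐ[volume] 0 := fun h0 => by
    obtain ⟨x, hx⟩ := h0.exists
    simp [(h.pos x).ne'] at hx
  have hnorm : ∫ x, ‖(φ x : ℂ)‖ ^ 2 = 1 := by
    simpa using h.normalized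
  have hsplit := integral_eq_add_integral_comp_neg hr.integrableOn_sq hl.integrableOn_sq
  rw [h.normalized] at hsplit
  set IR := ∫ x in Ioi 0, (ζ + 1 * x) * φ x ^ 2
  set IL := ∫ x in Ioi 0, (ζ + -a * x) * φ (-x) ^ 2
  -- Using φ as trial function at ζ + t avoids differentiating the band function: its energy is μ +
  -- 2t(IR + IL) + t², which is at least the minimum μ.
  have key : ∀ t : ℝ, 0 ≤ 2 * t * (IR + IL) + t ^ 2 := fun t => by
    have h1 : μ ≤ quadForm a (ζ + t) (fun x => (φ x : ℂ)) v := by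
      have := (stepConst_le a (ζ + t)).trans (bandFun_le hv hne)
      rwa [hnorm, div_one, ← hζ] at this
    have h2 : quadForm a (ζ + t) (fun x => (φ x : ℂ)) v =
        ∫ x, (φ' x ^ 2 + potential a (ζ + t) x * φ x ^ 2) := by
      refine integral_congr_ae ?_
      filter_upwards [hvφ] with x hx
      simp [hx]
    have gen : ∀ {k : ℝ} {f f' : ℝ → ℝ}, IsHalfLineState k ζ μ f f' →
        IntegrableOn (fun x => f' x ^ 2 + (ζ + t + k * x) ^ 2 * f x ^ 2) (Ioi 0) ∧
        ∫ x in Ioi 0, (f' x ^ 2 + (ζ + t + k * x) ^ 2 * f x ^ 2) =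
          -(f 0 * f' 0) + (μ + t ^ 2) * (∫ x in Ioi 0, f x ^ 2)
            + 2 * t * ∫ x in Ioi 0, (ζ + k * x) * f x ^ 2 := by
      intro k f f' hs
      have j0 := hs.integrableOn_sq
      have j1 : IntegrableOn (fun x => (ζ + k * x) * f x ^ 2) (Ioi 0) := by
        simpa using hs.integrableOn_pow_mul_sq 1
      have j2 : IntegrableOn (fun x => f' x ^ 2 + ((ζ + k * x) ^ 2 - μ) * f x ^ 2) (Ioi 0) := by
        refine (hs.integrableOn_deriv_sq.add
          ((hs.integrableOn_pow_mul_sq 2).sub (j0.const_mul μ))).congr_fun (fun x _ => ?_)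
          measurableSet_Ioi
        simp only [Pi.add_apply, Pi.sub_apply]
        ring
      -- Expanding around ζ isolates the energy integrand; its boundary terms -f(0) f'(0) from the
      -- two sides cancel.
      have e : (fun x => f' x ^ 2 + (ζ + t + k * x) ^ 2 * f x ^ 2) = fun x =>
          (f' x ^ 2 + ((ζ + k * x) ^ 2 - μ) * f x ^ 2) + (μ + t ^ 2) * f x ^ 2
            + 2 * t * ((ζ + k * x) * f x ^ 2) := by
        ext x; ring
      rw [e]
      have j3 : IntegrableOn (fun x => f' x ^ 2 + ((ζ + k * x) ^ 2 - μ) * f x ^ 2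
          + (μ + t ^ 2) * f x ^ 2) (Ioi 0) := j2.add (j0.const_mul (μ + t ^ 2))
      refine ⟨j3.add (j1.const_mul (2 * t)), ?_⟩
      rw [integral_add j3 (j1.const_mul (2 * t)), integral_add j2 (j0.const_mul _),
        hs.integral_energy, integral_const_mul, integral_const_mul]
    obtain ⟨r1, r2⟩ := gen hr
    obtain ⟨l1, l2⟩ := gen hl
    have cr : EqOn (fun x => φ' x ^ 2 + (ζ + t + 1 * x) ^ 2 * φ x ^ 2)
        (fun x => φ' x ^ 2 + potential a (ζ + t) x * φ x ^ 2) (Ioi 0) := fun x hx => by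
      simp only [potential_of_nonneg (le_of_lt hx)]
    have cl : EqOn (fun x => (-φ' (-x)) ^ 2 + (ζ + t + -a * x) ^ 2 * φ (-x) ^ 2)
        (fun x => φ' (-x) ^ 2 + potential a (ζ + t) (-x) * φ (-x) ^ 2) (Ioi 0) := fun x hx => by
      simp only [potential_neg_of_nonneg (le_of_lt hx), neg_sq]
    rw [h2, integral_eq_add_integral_comp_neg (r1.congr_fun cr measurableSet_Ioi)
      (l1.congr_fun cl measurableSet_Ioi), ← setIntegral_congr_fun measurableSet_Ioi cr,
      ← setIntegral_congr_fun measurableSet_Ioi cl, r2, l2] at h1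
    simp only [neg_zero] at h1
    linear_combination h1 - (μ + t ^ 2) * hsplit
  -- This choice of t minimizes the quadratic and gives -(IR + IL)² ≥ 0.
  have := key (-(IR + IL))
  nlinarith

end MagneticStep

/-! ### Moment formulas and the sign of the third moment -/

theorem proposition4p1 (a : ℝ) (ha : -1 ≤ a) (ha' : a < 0)
    (ζ : ℝ) (hζ : MagneticStep.bandFun a ζ = MagneticStep.stepConst a)
    (φ : ℝ → ℝ) (hφ : MagneticStep.IsGroundState a ζ φ) :
    DifferentiableAt ℝ φ 0 ∧
    (∀ n : ℕ, Integrable (MagneticStep.momentIntegrand a ζ φ n)) ∧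
    MagneticStep.moment a ζ φ 1 = 0 ∧
    MagneticStep.moment a ζ φ 2 =
      (1 / 2) * MagneticStep.stepConst a * (∫ τ, 1 / MagneticStep.step a τ * φ τ ^ 2)
        + (1 / 4) * (1 / a - 1) * φ 0 * deriv φ 0 ∧
    MagneticStep.moment a ζ φ 3 = (1 / 3) * (1 / a - 1) * ζ * φ 0 * deriv φ 0 ∧
    (-1 < a → MagneticStep.moment a ζ φ 3 < 0) := by
  obtain ⟨φ', hd, hr, hl, v, hv, hvφ⟩ := hφ.exists_halfLine ha'
  have hst := hφ.stationary hζ hr hl hv hvφ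
  have r1 := hr.moment_one
  have r2 := hr.moment_two
  have r3 := hr.moment_three
  have l1 := hl.moment_one
  have l2 := hl.moment_two
  have l3 := hl.moment_three
  simp only [neg_zero] at l1 l2 l3
  have cr : ∀ n, Set.EqOn (fun x => (ζ + 1 * x) ^ n * φ x ^ 2)
      (MagneticStep.momentIntegrand a ζ φ n) (Set.Ioi 0) := fun n x hx => by
    simp [MagneticStep.momentIntegrand, MagneticStep.step_of_pos hx]
  have cl : ∀ n, Set.EqOn (fun x => 1 / a * ((ζ + -a * x) ^ n * φ (-x) ^ 2))
      (fun x => MagneticStep.momentIntegrand a ζ φ n (-x)) (Set.Ioi 0) := fun n x hx => by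
    simp [MagneticStep.momentIntegrand, MagneticStep.step_neg_of_nonneg (le_of_lt hx)]
    ring
  have ir := fun n => (hr.integrableOn_pow_mul_sq n).congr_fun (cr n) measurableSet_Ioi
  have il := fun n => IntegrableOn.congr_fun
    ((hl.integrableOn_pow_mul_sq n).const_mul (1 / a)) (cl n) measurableSet_Ioi
  have hM : ∀ n, ∫ x, MagneticStep.momentIntegrand a ζ φ n x =
      (∫ x in Set.Ioi 0, (ζ + 1 * x) ^ n * φ x ^ 2)
        + 1 / a * ∫ x in Set.Ioi 0, (ζ + -a * x) ^ n * φ (-x) ^ 2 := fun n => by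
    rw [MagneticStep.integral_eq_add_integral_comp_neg (ir n) (il n),
      ← setIntegral_congr_fun measurableSet_Ioi (cr n),
      ← setIntegral_congr_fun measurableSet_Ioi (cl n), integral_const_mul]
  have hM0 : ∫ τ, 1 / MagneticStep.step a τ * φ τ ^ 2 =
      (∫ x in Set.Ioi 0, φ x ^ 2) + 1 / a * ∫ x in Set.Ioi 0, φ (-x) ^ 2 := by
    simpa [MagneticStep.momentIntegrand] using hM 0
  have hM1 := hM 1
  simp only [pow_one] at hM1
  have hM2 := hM 2
  have hM3 := hM 3
  rw [← MagneticStep.moment] at hM1 hM2 hM3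
  have hφ0 := hφ.pos 0
  have hderiv : deriv φ 0 = φ' 0 := (hd 0).deriv
  have hane : a ≠ 0 := ha'.ne
  have hinv : 1 / a * a = 1 := one_div_mul_cancel hane
  have hainv : 1 / a < 0 := one_div_neg.2 ha'
  set μ := MagneticStep.bandFun a ζ
  -- The half-line first moments are F/2 and -F/(2a), so stationarity reads (1 - 1/a) F = 0, with a
  -- positive factor.
  have hF : φ' 0 ^ 2 + (μ - ζ ^ 2) * φ 0 ^ 2 = 0 := by
    have : (1 - 1 / a) * (φ' 0 ^ 2 + (μ - ζ ^ 2) * φ 0 ^ 2) = 0 := by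
      linear_combination 2 * hst - r1 + 1 / a * l1
        + 2 * (∫ x in Set.Ioi 0, (ζ + -a * x) * φ (-x) ^ 2) * hinv
    exact (mul_eq_zero.1 this).resolve_left (by linarith)
  have hIR : ∫ x in Set.Ioi 0, (ζ + 1 * x) * φ x ^ 2 = 0 := by
    linear_combination (r1 + hF) / 2
  have hIL : ∫ x in Set.Ioi 0, (ζ + -a * x) * φ (-x) ^ 2 = 0 := by
    linear_combination hst - hIR
  have hζneg : ζ < 0 := not_le.1 fun h => (hr.moment_one_pos h).ne' hIR
  have l2' : 4 * (∫ x in Set.Ioi 0, (ζ + -a * x) ^ 2 * φ (-x) ^ 2)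
      - 2 * μ * (∫ x in Set.Ioi 0, φ (-x) ^ 2) = φ 0 * φ' 0 :=
    mul_left_cancel₀ hane (by linear_combination -l2 - ζ * hF)
  have l3' : 6 * (∫ x in Set.Ioi 0, (ζ + -a * x) ^ 3 * φ (-x) ^ 2) =
      2 * ζ * (φ 0 * φ' 0) - a * φ 0 ^ 2 :=
    mul_left_cancel₀ hane (by linear_combination -l3 - ζ ^ 2 * hF + 4 * μ * a * hIL)
  have e3 : MagneticStep.moment a ζ φ 3 = (1 / 3) * (1 / a - 1) * ζ * φ 0 * φ' 0 := by
    -- The contributions φ(0)²/6 from the right and -φ(0)²/6 from the left, the latter after the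
    -- weight 1/a, cancel.
    linear_combination hM3 + (r3 + ζ ^ 2 * hF + 4 * μ * hIR) / 6 + 1 / a * l3' / 6
      - φ 0 ^ 2 / 6 * hinv
  rw [hderiv, ← hζ]
  refine ⟨(hd 0).differentiableAt,
    fun n => MagneticStep.integrable_of_integrableOn_comp_neg (ir n) (il n), ?_, ?_, e3,
    fun ha1 => ?_⟩
  · rw [hM1, hIR, hIL]; ring
  · rw [hM0]
    linear_combination hM2 + (r2 + ζ * hF) / 4 + 1 / a * l2' / 4
  · rw [e3]
    -- The hypothesis -1 < a enters as slope -a < 1; the reflected slope at 0 is -φ'(0), nonpositive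
    -- under the contrary assumption.
    have hneg : φ' 0 < 0 := by
      by_contra! hcon
      refine absurd (hr.deriv_zero_neg_of_slope_lt_one hl (by linarith) hζneg
        (MagneticStep.bandFun_nonneg a ζ) ?_ ?_) (not_lt.2 hcon)
      · simpa using hF
      · simpa using hcon
    have h1 : 0 < ζ * φ' 0 * φ 0 := mul_pos (mul_pos_of_neg_of_neg hζneg hneg) hφ0
    have h2 : 1 / a - 1 < 0 := by linarith
    have := mul_neg_of_neg_of_pos h2 h1
    linarith
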